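/- Let $X\subset\mathbb R^2$ be a bounded connected open set with smooth boundary, equipped with the flat metric. A generalized geodesic of $\overline X$ is a curve $y:\mathbb R\to\overline X$, traveled at speed $1$, that is the projection (with time as parameter) of a generalized bicharacteristic of Melrose–Sjöstrand on $\mathbb R\times\overline X$: it is straight inside $X$, it reflects at isolated times at transversal points of $\partial X$ according to the laws of geometric optics, and at points where it is tangent to $\partial X$ it follows the free flow if the point is diffractive and the gliding flow along $\partial X$ otherwise. For $T>0$, a set $Q\subset\mathbb R\times\overline X$ satisfies the time-dependent geometric control condition ($t$-GCC) in time $T$ if every generalized geodesic $y$ has a time $t\in(0,T)$ with $(t,y(t))\in Q$. **Theorem.** For every sufficiently small $r_0>0$ there is a bounded connected open set $X\subset\mathbb R^2$ with smooth boundary of the form $X=U\setminus(D_1\cup D_2\cup D_3)$, where $D_1,D_2,D_3$ are closed disks of radius $r_0$ whose centers form an equilateral triangle of side length $1+2r_0$, and $U$ is a connected open set that contains the convex hull of $D_1\cup D_2\cup D_3$ and whose boundary $\Gamma$ is connected (the outer curve), such that the following holds. There are $\varepsilon_0,v_0>0$ such that for all $\varepsilon\in(0,\varepsilon_0]$, $v\in(0,v_0]$,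 all $T>0$ and every absolutely continuous path $x:[0,T]\to\overline X$ with $|\dot x(t)|\le v$ for almost every $t\in[0,T]$, the moving ball $\omega(t)=B(x(t),\varepsilon)\cap\overline X$, i.e. the set $Q=\{(t,q): t\in[0,T],\ q\in\omega(t)\}$, does not satisfy the $t$-GCC in time $T$. More precisely, there is a generalized geodesic $y$ that never touches $\Gamma$ (so that it only bounces on the three disks) and such that $y(t)\notin B(x(t),\varepsilon)$ for all $t\in[0,T]$. -/

import Mathlib

open Set Filter Topology MeasureTheory
open scoped ContDiff RealInnerProductSpace

noncomputable section

/-- The Euclidean plane, with its flat metric. -/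
abbrev Plane : Type := EuclideanSpace ℝ (Fin 2)

/-- `φ` is a smooth function that defines the open set `X` near the boundary point `p`: near `p`
the set `X` is `{φ > 0}`, and the gradient of `φ` at `p` (an inner normal) does not vanish. -/
structure IsBoundaryDefining (X : Set Plane) (p : Plane) (φ : Plane → ℝ) : Prop where
  smooth : ContDiff ℝ ∞ φ
  gradient_ne_zero : gradient φ p ≠ 0
  eventually_mem_iff : ∀ᶠ q in 𝓝 p, (q ∈ X ↔ 0 < φ q)

/-- The boundary of the planar set `X` is smooth, with `X` lying locally on one side of it. -/
def HasSmoothBoundary (X : Set Plane) : Prop :=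
  ∀ p ∈ frontier X, ∃ φ : Plane → ℝ, IsBoundaryDefining X p φ

/-- The acceleration of a generalized geodesic that is tangent to the boundary `{φ = 0}` at `p`,
with velocity `w`. It vanishes if `D²φ(w, w) ≥ 0`; this contains the diffractive points
(`D²φ(w, w) > 0`), where the flow is that of the free Hamiltonian field. At gliding points
(`D²φ(w, w) < 0`) it is the acceleration given by the gliding Hamiltonian field, i.e. the one that
keeps the motion tangent to the boundary, and at tangential points of higher order
(`D²φ(w, w) = 0`) both fields agree. -/
def tangentialAcceleration (φ : Plane → ℝ) (p w : Plane) : Plane :=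
  (max 0 (-(fderiv ℝ (fderiv ℝ φ) p w w)) / ‖gradient φ p‖ ^ 2) • gradient φ p

/-- The inner unit normal given by the defining function `φ`. -/
def innerNormal (φ : Plane → ℝ) (p : Plane) : Plane := ‖gradient φ p‖⁻¹ • gradient φ p

/-- `(y, w)` is a generalized bicharacteristic (in the sense of Melrose and Sjöstrand) of the wave
operator on `ℝ × closure X`, parametrized by time, with position `y t`, velocity `w t` and set of
reflection times `B`. The velocity is only meaningful at the times outside `B`. -/
structure IsGeneralizedBicharacteristic (X : Set Plane) (y w : ℝ → Plane) (B : Set ℝ) : Prop where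
  continuous : Continuous y
  mem_closure : ∀ t, y t ∈ closure X
  norm_eq_one : ∀ t, t ∉ B → ‖w t‖ = 1
  hasDeriv : ∀ t, t ∉ B → HasDerivWithinAt y (w t) Bᶜ t
  /-- Inside `X` the motion is free. -/
  interior : ∀ t, t ∉ B → y t ∈ X → HasDerivWithinAt w 0 Bᶜ t
  /-- At boundary points that are not reflection points the motion is tangent to the boundary, and
  it follows the free flow at diffractive points and the gliding flow at the others. -/
  tangential : ∀ t, t ∉ B → y t ∈ frontier X → ∃ φ, IsBoundaryDefining X (y t) φ ∧
    ⟪gradient φ (y t), w t⟫ = 0 ∧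
    HasDerivWithinAt w (tangentialAcceleration φ (y t) (w t)) Bᶜ t
  /-- Reflection times are isolated; the motion takes place in `X` just before and just after, and
  the (transversal) velocity jumps according to the law of geometric optics. -/
  reflection : ∀ t ∈ B, y t ∈ frontier X ∧ (∀ᶠ s in 𝓝[≠] t, s ∉ B ∧ y s ∈ X) ∧
    ∃ φ, IsBoundaryDefining X (y t) φ ∧ ∃ wl wr : Plane,
      Tendsto w (𝓝[<] t) (𝓝 wl) ∧ Tendsto w (𝓝[>] t) (𝓝 wr) ∧
      ⟪innerNormal φ (y t), wl⟫ ≠ 0 ∧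
      wr = wl - (2 * ⟪innerNormal φ (y t), wl⟫) • innerNormal φ (y t)

/-- A generalized geodesic of `closure X`, traveled at speed one: the projection of a generalized
bicharacteristic. -/
def IsGeneralizedGeodesic (X : Set Plane) (y : ℝ → Plane) : Prop :=
  ∃ (w : ℝ → Plane) (B : Set ℝ), IsGeneralizedBicharacteristic X y w B

/-- `(Q, T)` satisfies the time-dependent geometric control condition on `closure X`: every
generalized geodesic meets `Q` within the time interval `(0, T)`. -/
def SatisfiesTGCC (X : Set Plane) (Q : Set (ℝ × Plane)) (T : ℝ) : Prop :=
  ∀ y : ℝ → Plane, IsGeneralizedGeodesic X y → ∃ t ∈ Ioo 0 T, (t, y t) ∈ Q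

/-- `x` is an absolutely continuous path from `[0, T]` to `closure X` with speed at most `v`. -/
structure IsAdmissiblePath (X : Set Plane) (T v : ℝ) (x : ℝ → Plane) : Prop where
  absolutelyContinuous : AbsolutelyContinuousOnInterval x 0 T
  mem_closure : ∀ t ∈ Icc 0 T, x t ∈ closure X
  speed_le : ∀ᵐ t ∂(volume.restrict (Icc 0 T)), ‖deriv x t‖ ≤ v

/-- The moving ball `ω(t) = B(x(t), ε) ∩ closure X`, as a subset of space-time. -/
def movingBall (X : Set Plane) (T ε : ℝ) (x : ℝ → Plane) : Set (ℝ × Plane) :=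
  {p | p.1 ∈ Icc 0 T ∧ p.2 ∈ Metric.ball (x p.1) ε ∩ closure X}

/-- `X` is a bounded smooth domain obtained from the domain `U`, whose boundary is one closed curve
that encloses the convex hull of the three closed disks of radius `r₀` with centers `c i`, by
removing these disks. The centers form an equilateral triangle of side length `1 + 2 * r₀`. -/
structure IsThreeDiskDomain (r₀ : ℝ) (c : Fin 3 → Plane) (U X : Set Plane) : Prop where
  dist_eq : ∀ i j, i ≠ j → dist (c i) (c j) = 1 + 2 * r₀
  isOpen_outer : IsOpen U
  isConnected_outer : IsConnected U
  isConnected_outer_frontier : IsConnected (frontier U)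
  convexHull_subset : convexHull ℝ (⋃ i, Metric.closedBall (c i) r₀) ⊆ U
  eq_diff : X = U \ ⋃ i, Metric.closedBall (c i) r₀
  isOpen : IsOpen X
  isBounded : Bornology.IsBounded X
  isConnected : IsConnected X
  hasSmoothBoundary : HasSmoothBoundary X

end

noncomputable section

/-! The geodesic is built against the path, one leg at a time. Suppose that it leaves disk `i` when
the center of the slow ball is not near `c i`. That center cannot lie close to both sides of the
triangle at `c i`, so some side `[c i, c j]` is free and its far end is also at a safe distance
(`exists_side_far`). One leg takes time about 1, during which the ball hardly moves, so the leg to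
disk `j` is safe and the situation repeats.

The difficulty is circular: the bounce times of a billiard trajectory depend on its whole itinerary,
including disks not yet chosen. The way out is dynamic programming. The value function `V n`, the
least length of a chain through the disks chosen so far, depends only on the past. It is
1-Lipschitz, so evaluating it at the center of the current disk predicts the bounce time up to `r`,
whatever comes later (`exists_evading_itinerary`).

After `N > T` legs a shortest chain is traced back from the value functions and folded into a
bi-infinite one (`exists_isMinimalChain`). By Fermat's principle (`reflection_of_isMinOn`) and the
absence of eclipses, its polygonal line is a billiard trajectory with transversal reflections only
(`IsMinimalChain.isGeneralizedBicharacteristic`). -/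

/-! ### Slow paths are Lipschitz. -/

theorem AbsolutelyContinuousOnInterval.inner_const {E : Type*} [NormedAddCommGroup E]
    [InnerProductSpace ℝ E] {x : ℝ → E} {a b : ℝ} (hx : AbsolutelyContinuousOnInterval x a b)
    (e : E) : AbsolutelyContinuousOnInterval (fun t => ⟪e, x t⟫) a b := by
  rw [absolutelyContinuousOnInterval_iff] at hx ⊢
  intro ε hε
  obtain ⟨δ, hδ, h⟩ := hx (ε / (‖e‖ + 1)) (by positivity)
  refine ⟨δ, hδ, fun I hI hIδ => ?_⟩
  have h1 := h I hI hIδ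
  rw [lt_div_iff₀ (by positivity)] at h1
  refine lt_of_le_of_lt ?_ h1
  rw [Finset.sum_mul]
  refine Finset.sum_le_sum fun i _ => ?_
  rw [dist_eq_norm, dist_eq_norm, ← inner_sub_right]
  have := norm_inner_le_norm (𝕜 := ℝ) e (x (I.2 i).1 - x (I.2 i).2)
  nlinarith [norm_nonneg (x (I.2 i).1 - x (I.2 i).2)]

/-- An absolutely continuous path with speed at most `v` almost everywhere is `v`-Lipschitz. -/
theorem AbsolutelyContinuousOnInterval.dist_le_of_ae_norm_deriv_le {E : Type*}
    [NormedAddCommGroup E] [InnerProductSpace ℝ E] [FiniteDimensional ℝ E] {x : ℝ → E}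
    {a b v : ℝ} (hab : a ≤ b) (hv0 : 0 ≤ v) (hx : AbsolutelyContinuousOnInterval x a b)
    (hv : ∀ᵐ t, t ∈ Icc a b → ‖deriv x t‖ ≤ v) :
    dist (x a) (x b) ≤ v * (b - a) := by
  rcases eq_or_ne (x a) (x b) with h | h
  · rw [h, dist_self]
    exact mul_nonneg hv0 (by linarith)
  -- Testing against the displacement itself reduces the bound to the scalar fundamental theorem of
  -- calculus.
  set e : E := x b - x a with he
  have hepos : 0 < ‖e‖ := norm_pos_iff.2 (sub_ne_zero.2 h.symm)
  have hint := (hx.inner_const e).integral_deriv_eq_sub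
  have hbound : ‖∫ t in a..b, deriv (fun t => ⟪e, x t⟫) t‖ ≤ (‖e‖ * v) * |b - a| := by
    refine intervalIntegral.norm_integral_le_of_norm_le_const_ae ?_
    filter_upwards [hv, hx.boundedVariationOn.ae_differentiableAt_of_mem_uIcc] with t ht hd hmem
    have hmem' : t ∈ Icc a b := by
      rw [uIoc_of_le hab] at hmem
      exact Ioc_subset_Icc_self hmem
    have hd' := hd (by rwa [uIcc_of_le hab])
    have : HasDerivAt (fun t => ⟪e, x t⟫) ⟪e, deriv x t⟫ t := by
      simpa using (hasDerivAt_const t e).inner ℝ hd'.hasDerivAt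
    rw [this.deriv]
    exact (norm_inner_le_norm _ _).trans (mul_le_mul_of_nonneg_left (ht hmem') (norm_nonneg _))
  rw [hint, ← inner_sub_right, ← he, real_inner_self_eq_norm_sq, abs_of_nonneg (by linarith),
    Real.norm_of_nonneg (by positivity)] at hbound
  rw [dist_comm, dist_eq_norm, ← he]
  nlinarith

theorem IsAdmissiblePath.dist_le {X : Set Plane} {T v : ℝ} {x : ℝ → Plane}
    (hx : IsAdmissiblePath X T v x) (hv : 0 ≤ v) {s t : ℝ} (hs : 0 ≤ s) (hst : s ≤ t) (ht : t ≤ T) :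
    dist (x s) (x t) ≤ v * (t - s) := by
  have hT : 0 ≤ T := by linarith
  refine (hx.absolutelyContinuous.mono ?_).dist_le_of_ae_norm_deriv_le hst hv ?_
  · rw [uIcc_of_le hst, uIcc_of_le hT]
    exact Icc_subset_Icc hs ht
  · have := (ae_restrict_iff' measurableSet_Icc).1 hx.speed_le
    filter_upwards [this] with r hr hmem
    exact hr ⟨hs.trans hmem.1, hmem.2.trans ht⟩

/-- Extending the path by constants gives a Lipschitz map on the whole line. -/
theorem IsAdmissiblePath.dist_projIcc_le {X : Set Plane} {T v : ℝ} {x : ℝ → Plane}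
    (hT : 0 ≤ T) (hv : 0 ≤ v) (hx : IsAdmissiblePath X T v x) (s t : ℝ) :
    dist (x (projIcc 0 T hT s)) (x (projIcc 0 T hT t)) ≤ v * |s - t| := by
  wlog hst : s ≤ t generalizing s t
  · rw [dist_comm, abs_sub_comm]
    exact this t s (by linarith)
  refine (hx.dist_le hv (projIcc 0 T hT s).2.1 (monotone_projIcc hT hst)
    (projIcc 0 T hT t).2.2).trans ?_
  refine mul_le_mul_of_nonneg_left ?_ hv
  have := abs_projIcc_sub_projIcc (c := t) (d := s) hT
  rw [abs_sub_comm s t]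
  exact (le_abs_self _).trans this

/-! ### Fermat's principle for a ball. -/

section Reflection

variable {E : Type*} [NormedAddCommGroup E] [InnerProductSpace ℝ E]

theorem hasDerivAt_norm_add_smul {q u : E} (hq : q ≠ 0) :
    HasDerivAt (fun t : ℝ => ‖q + t • u‖) (⟪‖q‖⁻¹ • q, u⟫) 0 := by
  have h1 : HasDerivAt (fun t : ℝ => q + t • u) u 0 := by
    simpa using ((hasDerivAt_id (0 : ℝ)).smul_const u).const_add q
  have h2 := h1.norm_sq.sqrt (by simpa using hq)
  have hq' : ‖q‖ ≠ 0 := norm_ne_zero_iff.2 hq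
  convert h2 using 1
  · ext t
    rw [Real.sqrt_sq (norm_nonneg _)]
  · simp only [zero_smul, add_zero, Real.sqrt_sq (norm_nonneg _), real_inner_smul_left]
    field_simp

/-- Fermat's principle: a point of a ball at which the sum of the distances to two points is
minimal, and which does not lie between these points, is a point of the sphere at which the broken
line is reflected transversally. -/
theorem reflection_of_isMinOn {a b c p : E} {r : ℝ} (hr : 0 < r)
    (hp : p ∈ Metric.closedBall c r) (ha : a ≠ p) (hb : b ≠ p) (hseg : p ∉ segment ℝ a b)
    (hmin : ∀ z ∈ Metric.closedBall c r, dist a p + dist p b ≤ dist a z + dist z b) :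
    ‖p - c‖ = r ∧ ⟪p - c, ‖p - a‖⁻¹ • (p - a)⟫ < 0 ∧ 0 < ⟪p - c, ‖b - p‖⁻¹ • (b - p)⟫ ∧
      ‖b - p‖⁻¹ • (b - p) = ‖p - a‖⁻¹ • (p - a) -
        (2 * ⟪‖p - c‖⁻¹ • (p - c), ‖p - a‖⁻¹ • (p - a)⟫) • (‖p - c‖⁻¹ • (p - c)) := by
  have hpa : 0 < ‖p - a‖ := norm_pos_iff.2 (sub_ne_zero.2 ha.symm)
  have hbp : 0 < ‖b - p‖ := norm_pos_iff.2 (sub_ne_zero.2 hb)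
  set l : E := ‖p - a‖⁻¹ • (p - a) with hl
  set m : E := ‖b - p‖⁻¹ • (b - p) with hm
  have hl1 : ‖l‖ = 1 := by rw [hl, norm_smul, norm_inv, norm_norm, inv_mul_cancel₀ hpa.ne']
  have hm1 : ‖m‖ = 1 := by rw [hm, norm_smul, norm_inv, norm_norm, inv_mul_cancel₀ hbp.ne']
  -- `l - m` is the gradient at `p` of the sum of distances. The ball is convex, so the one-sided
  -- derivative towards any of its points is nonnegative.
  have hg : ∀ z ∈ Metric.closedBall c r, 0 ≤ ⟪l - m, z - p⟫ := by
    intro z hz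
    have hd := (hasDerivAt_norm_add_smul (u := z - p) (sub_ne_zero.2 ha.symm)).add
      (hasDerivAt_norm_add_smul (u := z - p) (sub_ne_zero.2 hb.symm))
    have hval : ⟪‖p - a‖⁻¹ • (p - a), z - p⟫ + ⟪‖p - b‖⁻¹ • (p - b), z - p⟫ = ⟪l - m, z - p⟫ := by
      rw [hl, hm, inner_sub_left, norm_sub_rev p b, ← neg_sub b p, smul_neg, inner_neg_left]
      ring
    rw [hval] at hd
    by_contra hneg
    push Not at hneg
    have hev := (hasDerivAt_iff_tendsto_slope_zero.1 hd).eventually (gt_mem_nhds hneg)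
    have hev' : ∀ᶠ t : ℝ in 𝓝[>] 0, _ := hev.filter_mono
      (nhdsWithin_mono 0 (fun t (ht : 0 < t) => ht.ne'))
    obtain ⟨t, ht, ht01⟩ := (hev'.and (Ioo_mem_nhdsGT (zero_lt_one))).exists
    have hzt : p + t • (z - p) ∈ Metric.closedBall c r := by
      refine (convex_closedBall c r).add_smul_sub_mem hp hz ⟨ht01.1.le, ht01.2.le⟩
    have h1 := hmin _ hzt
    simp only [zero_add, zero_smul, add_zero, smul_eq_mul, Pi.add_apply] at ht
    rw [dist_eq_norm' a p, dist_eq_norm p b, dist_eq_norm' a, dist_eq_norm _ b] at h1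
    have e1 : p + t • (z - p) - a = p - a + t • (z - p) := by abel
    have e2 : p + t • (z - p) - b = p - b + t • (z - p) := by abel
    rw [e1, e2] at h1
    have : 0 ≤ t⁻¹ * (‖p - a + t • (z - p)‖ + ‖p - b + t • (z - p)‖ - (‖p - a‖ + ‖p - b‖)) :=
      mul_nonneg (inv_nonneg.2 ht01.1.le) (by linarith)
    linarith
  have hgne : l - m ≠ 0 := by
    intro h0
    apply hseg
    rw [sub_eq_zero] at h0
    have h3 : SameRay ℝ (p - a) (b - p) := by
      rw [sameRay_iff_inv_norm_smul_eq]
      exact Or.inr (Or.inr h0)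
    exact mem_segment_iff_sameRay.2 h3
  set g : E := l - m with hgdef
  have hgpos : 0 < ‖g‖ := norm_pos_iff.2 hgne
  -- This is where the linear functional `⟪g, ·⟫` is least on the ball. Comparison with it forces
  -- equality in Cauchy–Schwarz, which puts `p` on the sphere with `g` along the normal.
  have hz : c - (r * ‖g‖⁻¹) • g ∈ Metric.closedBall c r := by
    rw [Metric.mem_closedBall, dist_eq_norm, sub_sub_cancel_left, norm_neg, norm_smul, norm_mul,
      norm_inv, norm_norm, Real.norm_of_nonneg hr.le, mul_assoc, inv_mul_cancel₀ hgpos.ne', mul_one]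
  have h1 := hg _ hz
  have h2 : ⟪g, c - (r * ‖g‖⁻¹) • g - p⟫ = ⟪g, c - p⟫ - r * ‖g‖ := by
    rw [sub_right_comm, inner_sub_right, real_inner_smul_right, real_inner_self_eq_norm_sq]
    field_simp
  rw [h2] at h1
  have hcp : ‖c - p‖ ≤ r := by rwa [← dist_eq_norm, ← Metric.mem_closedBall']
  have h4 := real_inner_le_norm g (c - p)
  have hcp' : ‖c - p‖ = r := by
    apply le_antisymm hcp
    nlinarith
  have hpc : ‖p - c‖ = r := by rw [norm_sub_rev, hcp']
  have h5 : ⟪g, c - p⟫ = ‖g‖ * ‖c - p‖ := le_antisymm h4 (by rw [hcp']; linarith)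
  have h6 := inner_eq_norm_mul_iff_real.1 h5
  rw [hcp'] at h6
  -- `g` is a negative multiple of the outer normal
  set n : E := ‖p - c‖⁻¹ • (p - c) with hn
  have hn1 : ‖n‖ = 1 := by
    rw [hn, norm_smul, norm_inv, norm_norm, inv_mul_cancel₀ (by rw [hpc]; exact hr.ne')]
  have hpcn : p - c = r • n := by
    rw [hn, hpc, smul_smul, mul_inv_cancel₀ hr.ne', one_smul]
  have hgn : g = -(‖g‖ • n) := by
    have : r • g = r • -(‖g‖ • n) := by
      rw [h6, ← neg_sub p c, hpcn, smul_neg, smul_neg, smul_comm]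
    exact smul_right_injective E hr.ne' this
  have hml : m = l + ‖g‖ • n := by
    rw [← sub_eq_iff_eq_add', ← neg_sub l m, ← hgdef]
    nth_rw 1 [hgn]
    exact neg_neg _
  -- Since `l` and `m = l + ‖g‖ • n` are both unit vectors, the normal component of `l` is
  -- determined. It is nonzero because `g ≠ 0`, hence transversality.
  have hnl : ⟪n, l⟫ = -‖g‖ / 2 := by
    have h7 : ‖m‖ ^ 2 = ‖l‖ ^ 2 + 2 * (‖g‖ * ⟪n, l⟫) + ‖g‖ ^ 2 := by
      rw [hml, norm_add_sq_real, real_inner_smul_right, real_inner_comm, norm_smul ‖g‖ n, norm_norm, hn1]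
      ring
    rw [hl1, hm1] at h7
    have h8 : ‖g‖ * (2 * ⟪n, l⟫ + ‖g‖) = 0 := by linarith
    rcases mul_eq_zero.1 h8 with h | h
    · exact absurd h hgpos.ne'
    · linarith
  refine ⟨hpc, ?_, ?_, ?_⟩
  · rw [hpcn, real_inner_smul_left, hnl]
    nlinarith
  · rw [hpcn, hml, real_inner_smul_left, inner_add_right, real_inner_smul_right n n,
      real_inner_self_eq_norm_sq, hnl, hn1]
    have : 0 < r * ‖g‖ := mul_pos hr hgpos
    nlinarith
  · rw [hnl, hml, show 2 * (-‖g‖ / 2) = -‖g‖ by ring, neg_smul, sub_neg_eq_add]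

end Reflection

/-! ### Removing a ball from a connected set. -/

/-- In dimension at least two, removing a closed ball from a connected open set leaves a connected
set. -/
theorem IsPreconnected.diff_closedBall {E : Type*} [NormedAddCommGroup E] [NormedSpace ℝ E]
    (hE : 1 < Module.rank ℝ E) {V : Set E} (hV : IsPreconnected V) {c : E}
    {r r' : ℝ} (hr : 0 ≤ r) (hrr : r < r') (hsub : Metric.ball c r' ⊆ V) :
    IsPreconnected (V \ Metric.closedBall c r) := by
  set K := Metric.closedBall c r
  set A := Metric.ball c r' \ K with hA
  have hAconn : IsPreconnected A := by
    have himg : A = (fun q : ℝ × E => c + q.1 • q.2) '' (Ioo r r' ×ˢ Metric.sphere 0 1) := by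
      ext z
      constructor
      · rintro ⟨h1, h2⟩
        rw [Metric.mem_ball, dist_eq_norm] at h1
        rw [Metric.mem_closedBall, dist_eq_norm, not_le] at h2
        have hz : ‖z - c‖ ≠ 0 := by linarith
        refine ⟨(‖z - c‖, ‖z - c‖⁻¹ • (z - c)), ⟨⟨h2, h1⟩, ?_⟩, ?_⟩
        · simp [norm_smul, inv_mul_cancel₀ hz]
        · simp [smul_smul, mul_inv_cancel₀ hz]
      · rintro ⟨⟨ρ, s⟩, ⟨⟨h1, h2⟩, h3⟩, rfl⟩
        have hs : ‖s‖ = 1 := by simpa using h3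
        simp only at h1 h2
        have hρ : 0 < ρ := by linarith
        simp [hA, K, norm_smul, hs, abs_of_pos hρ, h1, h2]
    rw [himg]
    refine (isPreconnected_Ioo.prod (isConnected_sphere hE 0 zero_le_one).isPreconnected).image _ ?_
    fun_prop
  rw [isPreconnected_iff_subset_of_disjoint]
  have key : ∀ u v : Set E, IsOpen u → IsOpen v → V \ K ⊆ u ∪ v → V \ K ∩ (u ∩ v) = ∅ → A ⊆ u →
      V \ K ⊆ u := by
    intro u v hu hv huv hd hAu
    have hAVK : A ⊆ V \ K := sdiff_subset_sdiff_left hsub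
    have hcK : c ∈ K := Metric.mem_closedBall_self hr
    have hcB : c ∈ Metric.ball c r' := Metric.mem_ball_self (by linarith)
    -- The annulus `A` lies on the side of `u`, so filling the ball back in on that side turns a
    -- separation of `V \ K` into one of `V`.
    have := isPreconnected_iff_subset_of_disjoint.1 hV (u ∪ Metric.ball c r') (v \ K)
      (hu.union Metric.isOpen_ball) (hv.sdiff Metric.isClosed_closedBall) ?_ ?_
    · rcases this with h | h
      · rintro z ⟨hzV, hzK⟩
        rcases h hzV with h' | h'
        · exact h'
        · exact hAu ⟨h', hzK⟩
      · exact absurd hcK (h (hsub hcB)).2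
    · intro z hz
      by_cases hzK : z ∈ K
      · exact Or.inl (Or.inr (Metric.closedBall_subset_ball hrr hzK))
      · rcases huv ⟨hz, hzK⟩ with h | h
        · exact Or.inl (Or.inl h)
        · exact Or.inr ⟨h, hzK⟩
    · rw [eq_empty_iff_forall_notMem] at hd ⊢
      rintro z ⟨hzV, hz1, hzv, hzK⟩
      have hzu : z ∈ u := by
        rcases hz1 with h | h
        · exact h
        · exact hAu ⟨h, hzK⟩
      exact hd z ⟨⟨hzV, hzK⟩, hzu, hzv⟩
  intro u v hu hv huv hd
  have hAVK : A ⊆ V \ K := sdiff_subset_sdiff_left hsub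
  rcases isPreconnected_iff_subset_of_disjoint.1 hAconn u v hu hv (hAVK.trans huv)
    (subset_eq_empty (inter_subset_inter_left _ hAVK) hd) with h | h
  · exact Or.inl (key u v hu hv huv hd h)
  · exact Or.inr (key v u hv hu (by rwa [union_comm]) (by rwa [inter_comm v u]) h)


/-! ### Geometry of the equilateral triangle. -/

section Triangle

variable {E : Type*} [NormedAddCommGroup E] [InnerProductSpace ℝ E]

/-- A point that is far from a vertex of an equilateral triangle is away from one of the two sides
at that vertex and from the other endpoint of that side. -/
theorem exists_side_far {c : Fin 3 → E} {L : ℝ} (hc : ∀ i j, i ≠ j → dist (c i) (c j) = L)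
    (hL : 1 ≤ L) {i : Fin 3} {x : E} (hx : 1 / 4 ≤ dist x (c i)) :
    ∃ j, j ≠ i ∧ L + 1 / 40 ≤ dist x (c i) + dist x (c j) ∧ 3 / 10 ≤ dist x (c j) := by
  obtain ⟨j, k, hj, hk, hjk⟩ : ∃ j k : Fin 3, j ≠ i ∧ k ≠ i ∧ j ≠ k := by
    clear hx
    revert i
    decide
  by_contra! hcon
  have hj' := hcon j hj
  have hk' := hcon k hk
  have d1 := dist_triangle_left (c i) (c j) x
  have d2 := dist_triangle_left (c i) (c k) x
  have d3 := dist_triangle_left (c j) (c k) x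
  rw [hc i j hj.symm] at d1
  rw [hc i k hk.symm] at d2
  rw [hc j k hjk] at d3
  -- Otherwise `x` is within `3 / 10` of `c j`, hence far from both `c i` and `c k`, and `k` would
  -- be a valid choice. So `x` lies in the thin ellipses about both sides.
  have hb : dist x (c i) + dist x (c j) < L + 1 / 40 := by
    by_contra! h
    have h1 := hj' h
    have h2 : L + 1 / 40 ≤ dist x (c i) + dist x (c k) := by linarith
    linarith [hk' h2]
  have hc' : dist x (c i) + dist x (c k) < L + 1 / 40 := by
    by_contra! h
    linarith [hk' h]
  set u := x - c i
  set e := c j - c i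
  set f := c k - c i
  have ha1 : dist x (c i) = ‖u‖ := dist_eq_norm _ _
  have hb1 : dist x (c j) = ‖u - e‖ := by rw [dist_eq_norm]; congr 1; simp [u, e]
  have hc1 : dist x (c k) = ‖u - f‖ := by rw [dist_eq_norm]; congr 1; simp [u, f]
  have he : ‖e‖ = L := by rw [← dist_eq_norm, hc j i hj]
  have hf : ‖f‖ = L := by rw [← dist_eq_norm, hc k i hk]
  have hef : ‖e - f‖ = L := by rw [← hc j k hjk, dist_eq_norm]; congr 1; simp [e, f]
  rw [ha1] at hx hb hc'
  rw [hb1] at hb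
  rw [hc1] at hc'
  have h1 := norm_sub_sq_real u e
  have h2 := norm_sub_sq_real u f
  have h3 := norm_sub_sq_real e f
  have h4 := norm_add_sq_real e f
  have h5 := real_inner_le_norm u (e + f)
  rw [inner_add_right] at h5
  rw [he] at h1 h3 h4
  rw [hf] at h2 h3 h4
  rw [hef] at h3
  -- The norm is `√3 * L`. Lying in both ellipses would push `⟪u, e + f⟫` close to `2 * L * ‖u‖`;
  -- the gap between `7 / 4` and `2`, together with `‖u‖ ≥ 1 / 4`, absorbs the tolerance `1 / 40`.
  have h6 : ‖e + f‖ ≤ 7 / 4 * L := by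
    apply abs_le_of_sq_le_sq' _ (by linarith) |>.2
    nlinarith
  have h7 : ‖u‖ * ‖e + f‖ ≤ ‖u‖ * (7 / 4 * L) := mul_le_mul_of_nonneg_left h6 (norm_nonneg _)
  have h8 : ‖u - e‖ ^ 2 ≤ (L + 1 / 40 - ‖u‖) ^ 2 :=
    pow_le_pow_left₀ (norm_nonneg _) (by linarith) 2
  have h9 : ‖u - f‖ ^ 2 ≤ (L + 1 / 40 - ‖u‖) ^ 2 :=
    pow_le_pow_left₀ (norm_nonneg _) (by linarith) 2
  have h10 : 1 / 4 * L ≤ ‖u‖ * L := mul_le_mul_of_nonneg_right hx (by linarith)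
  nlinarith

theorem exists_vertex_far {E : Type*} [PseudoMetricSpace E] {c : Fin 3 → E} {L : ℝ} (hc : ∀ i j, i ≠ j → dist (c i) (c j) = L)
    (hL : 1 ≤ L) (x : E) : ∃ i, 1 / 4 ≤ dist x (c i) := by
  by_contra! h
  have := dist_triangle_left (c 0) (c 1) x
  rw [hc 0 1 (by decide)] at this
  linarith [h 0, h 1]

/-- Legs stay in a thin ellipse with foci at the centers. The excess `4 * r` is what is compared
with the excess `1 / 40` of the evaded path. -/
theorem dist_add_dist_le_of_mem_segment {a b p q z : E} {r : ℝ} (hp : p ∈ Metric.closedBall a r)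
    (hq : q ∈ Metric.closedBall b r) (hz : z ∈ segment ℝ p q) :
    dist z a + dist z b ≤ dist a b + 4 * r := by
  have h1 := dist_add_dist_of_mem_segment hz
  have h2 := dist_triangle z p a
  have h3 := dist_triangle z q b
  have h4 := dist_triangle4 p a b q
  rw [Metric.mem_closedBall] at hp hq
  rw [dist_comm z p] at h2
  rw [dist_comm b q] at h4
  linarith

/-- No eclipse: a segment between two disks does not meet another disk. -/
theorem notMem_closedBall_of_mem_segment {c : Fin 3 → E} {L r : ℝ}
    (hc : ∀ i j, i ≠ j → dist (c i) (c j) = L) (hr : 0 ≤ r) (hL : 6 * r < L) {i j k : Fin 3}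
    (hik : i ≠ k) (hjk : j ≠ k) {p q z : E} (hp : p ∈ Metric.closedBall (c i) r)
    (hq : q ∈ Metric.closedBall (c j) r) (hz : z ∈ segment ℝ p q) :
    z ∉ Metric.closedBall (c k) r := by
  intro hzk
  rw [Metric.mem_closedBall] at hzk
  -- A point of disk `k` has distances at least `L - r` to the other centers, and `2 * L - 2 * r > L
  -- + 4 * r`. The case `i = j`, a bounce straight back, is included.
  have h1 := dist_add_dist_le_of_mem_segment hp hq hz
  have h2 := dist_triangle_left (c i) (c k) z
  have h3 := dist_triangle_left (c j) (c k) z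
  rw [hc i k hik] at h2
  rw [hc j k hjk] at h3
  have h4 : dist (c i) (c j) ≤ L := by
    rcases eq_or_ne i j with rfl | h
    · rw [dist_self]; linarith
    · exact (hc i j h).le
  linarith

end Triangle

/-! ### The three-disk domain. -/

/-- The vertices of an equilateral triangle with side length `L`. -/
def triangleVertex (L : ℝ) : Fin 3 → Plane :=
  ![!₂[0, 0], !₂[L, 0], !₂[L / 2, √3 / 2 * L]]

theorem dist_triangleVertex {L : ℝ} (hL : 0 ≤ L) (i j : Fin 3) (hij : i ≠ j) :
    dist (triangleVertex L i) (triangleVertex L j) = L := by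
  have h3 : √3 ^ 2 * L ^ 2 = 3 * L ^ 2 := by rw [Real.sq_sqrt (by norm_num)]
  rw [EuclideanSpace.dist_eq, Fin.sum_univ_two, Real.sqrt_eq_iff_eq_sq (by positivity) hL]
  fin_cases i <;> fin_cases j <;>
    first
    | exact absurd rfl hij
    | (simp [triangleVertex, Real.dist_eq, abs_div, abs_of_nonneg hL,
        abs_of_nonneg (Real.sqrt_nonneg 3)] <;> nlinarith)

theorem norm_triangleVertex_le {L : ℝ} (hL : 0 ≤ L) (i : Fin 3) : ‖triangleVertex L i‖ ≤ L := by
  have h0 : triangleVertex L 0 = 0 := by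
    ext k
    fin_cases k <;> simp [triangleVertex]
  rcases eq_or_ne i 0 with rfl | h
  · simpa [h0] using hL
  · rw [← sub_zero (triangleVertex L i), ← h0, ← dist_eq_norm, dist_triangleVertex hL i 0 h]

section Domain

variable {c : Fin 3 → Plane} {r R L : ℝ}

/-- A large disk around the origin with three closed disks removed. -/
def threeDiskDomain (c : Fin 3 → Plane) (r R : ℝ) : Set Plane :=
  Metric.ball 0 R \ ⋃ i, Metric.closedBall (c i) r

theorem isOpen_threeDiskDomain : IsOpen (threeDiskDomain c r R) :=
  Metric.isOpen_ball.sdiff (isClosed_iUnion_of_finite fun _ => Metric.isClosed_closedBall)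

theorem mem_threeDiskDomain {q : Plane} :
    q ∈ threeDiskDomain c r R ↔ ‖q‖ < R ∧ ∀ i, r < dist q (c i) := by
  simp [threeDiskDomain]

theorem hasGradientAt_norm_sub_sq (c p : Plane) :
    HasGradientAt (fun q => ‖q - c‖ ^ 2) ((2 : ℝ) • (p - c)) p := by
  rw [hasGradientAt_iff_hasFDerivAt]
  refine ((hasFDerivAt_id p).sub_const c).norm_sq.congr_fderiv ?_
  ext v
  simp

theorem gradient_norm_sub_sq_sub (c p : Plane) (k : ℝ) :
    gradient (fun q => ‖q - c‖ ^ 2 - k) p = (2 : ℝ) • (p - c) := by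
  have := hasGradientAt_norm_sub_sq c p
  rw [hasGradientAt_iff_hasFDerivAt] at this
  have h2 := this.sub_const k
  rw [← hasGradientAt_iff_hasFDerivAt] at h2
  exact h2.gradient

theorem gradient_sub_norm_sub_sq (c p : Plane) (k : ℝ) :
    gradient (fun q => k - ‖q - c‖ ^ 2) p = -((2 : ℝ) • (p - c)) := by
  have := hasGradientAt_norm_sub_sq c p
  rw [hasGradientAt_iff_hasFDerivAt] at this
  have h2 := this.const_sub k
  rw [← map_neg, ← hasGradientAt_iff_hasFDerivAt] at h2
  exact h2.gradient

theorem isBoundaryDefining_disk (hc : ∀ i j, i ≠ j → dist (c i) (c j) = L) (hr : 0 < r)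
    (hL : 2 * r < L) (hR : ∀ i, ‖c i‖ + r < R) {i : Fin 3} {p : Plane} (hp : ‖p - c i‖ = r) :
    IsBoundaryDefining (threeDiskDomain c r R) p (fun q => ‖q - c i‖ ^ 2 - r ^ 2) where
  smooth := (contDiff_id.sub contDiff_const).norm_sq ℝ |>.sub contDiff_const
  gradient_ne_zero := by
    rw [gradient_norm_sub_sq_sub]
    refine smul_ne_zero two_ne_zero fun h => ?_
    rw [h, norm_zero] at hp
    exact hr.ne hp
  eventually_mem_iff := by
    have h1 : ∀ᶠ q in 𝓝 p, ‖q‖ < R := by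
      refine continuous_norm.continuousAt.eventually_lt_const ?_
      have := norm_sub_norm_le p (c i)
      linarith [hR i]
    have h2 : ∀ᶠ q in 𝓝 p, ∀ j, j ≠ i → r < dist q (c j) := by
      rw [eventually_all]
      intro j
      by_cases hj : j = i
      · simp [hj]
      · have : r < dist p (c j) := by
          have := dist_triangle_left (c i) (c j) p
          rw [hc i j (Ne.symm hj), dist_eq_norm p (c i), hp] at this
          linarith
        filter_upwards [(continuous_id.dist continuous_const).continuousAt.eventually_const_lt this]
          with q hq _ using hq
    filter_upwards [h1, h2] with q hq1 hq2
    rw [mem_threeDiskDomain, sub_pos, sq_lt_sq₀ hr.le (norm_nonneg _), ← dist_eq_norm]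
    refine ⟨fun h => h.2 i, fun h => ⟨hq1, fun j => ?_⟩⟩
    rcases eq_or_ne j i with rfl | hj
    · exact h
    · exact hq2 j hj

theorem innerNormal_disk (hr : 0 < r) {i : Fin 3} {p : Plane} (hp : ‖p - c i‖ = r) :
    innerNormal (fun q => ‖q - c i‖ ^ 2 - r ^ 2) p = ‖p - c i‖⁻¹ • (p - c i) := by
  rw [innerNormal, gradient_norm_sub_sq_sub, norm_smul, smul_smul]
  congr 1
  rw [hp, Real.norm_of_nonneg zero_le_two]
  field_simp

theorem isBoundaryDefining_outer (hR0 : 0 < R) (hR : ∀ i, ‖c i‖ + r < R) {p : Plane}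
    (hp : ‖p‖ = R) :
    IsBoundaryDefining (threeDiskDomain c r R) p (fun q => R ^ 2 - ‖q - 0‖ ^ 2) where
  smooth := contDiff_const.sub ((contDiff_id.sub contDiff_const).norm_sq ℝ)
  gradient_ne_zero := by
    rw [gradient_sub_norm_sub_sq, neg_ne_zero, sub_zero]
    refine smul_ne_zero two_ne_zero fun h => ?_
    rw [h, norm_zero] at hp
    exact hR0.ne hp
  eventually_mem_iff := by
    have h2 : ∀ᶠ q in 𝓝 p, ∀ j, r < dist q (c j) := by
      rw [eventually_all]
      intro j
      refine (continuous_id.dist continuous_const).continuousAt.eventually_const_lt ?_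
      have := norm_sub_norm_le p (c j)
      rw [← dist_eq_norm] at this
      exact lt_of_lt_of_le (by linarith [hR j]) this
    filter_upwards [h2] with q hq2
    rw [mem_threeDiskDomain, sub_pos, sq_lt_sq₀ (norm_nonneg _) hR0.le, sub_zero]
    exact ⟨fun h => h.1, fun h => ⟨h, hq2⟩⟩

theorem hasSmoothBoundary_threeDiskDomain (hc : ∀ i j, i ≠ j → dist (c i) (c j) = L) (hr : 0 < r)
    (hL : 2 * r < L) (hR0 : 0 < R) (hR : ∀ i, ‖c i‖ + r < R) :
    HasSmoothBoundary (threeDiskDomain c r R) := by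
  intro p hp
  rw [isOpen_threeDiskDomain.frontier_eq] at hp
  have hpR : ‖p‖ ≤ R :=
    closure_minimal (fun q hq => (mem_threeDiskDomain.1 hq).1.le)
      (isClosed_le continuous_norm continuous_const) hp.1
  rcases hpR.lt_or_eq with h | h
  · have : ∃ i, dist p (c i) ≤ r := by
      by_contra! h'
      exact hp.2 (mem_threeDiskDomain.2 ⟨h, h'⟩)
    obtain ⟨i, hi⟩ := this
    have hi' : r ≤ dist p (c i) :=
      closure_minimal (fun q hq => ((mem_threeDiskDomain.1 hq).2 i).le)
        (isClosed_le continuous_const (continuous_id.dist continuous_const)) hp.1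
    refine ⟨_, isBoundaryDefining_disk hc hr hL hR (i := i) ?_⟩
    rw [← dist_eq_norm]
    exact le_antisymm hi hi'
  · exact ⟨_, isBoundaryDefining_outer hR0 hR h⟩

theorem one_lt_rank_plane : 1 < Module.rank ℝ Plane := by
  rw [← Module.finrank_eq_rank, finrank_euclideanSpace_fin]
  norm_num

theorem isPreconnected_threeDiskDomain (hc : ∀ i j, i ≠ j → dist (c i) (c j) = L) (hr : 0 ≤ r)
    (hL : 2 * r < L) (hR : ∀ i, ‖c i‖ + r < R) : IsPreconnected (threeDiskDomain c r R) := by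
  have key : ∀ s : Finset (Fin 3),
      IsPreconnected (Metric.ball (0 : Plane) R \ ⋃ i ∈ s, Metric.closedBall (c i) r) := by
    intro s
    induction s using Finset.induction_on with
    | empty => simpa using (convex_ball (0 : Plane) R).isPreconnected
    | insert i s hi ih =>
      rw [Finset.set_biUnion_insert, union_comm, ← sdiff_sdiff]
      have h1 : 0 < R - ‖c i‖ - r := by linarith [hR i]
      have h2 : 0 < L - 2 * r := by linarith
      -- The width of the collar is at most the gaps to the outer circle and to the other disks.
      refine ih.diff_closedBall one_lt_rank_plane (r' := r + min (R - ‖c i‖ - r) (L - 2 * r)) hr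
        (by linarith [lt_min h1 h2]) ?_
      intro z hz
      rw [Metric.mem_ball] at hz
      have h3 := min_le_left (R - ‖c i‖ - r) (L - 2 * r)
      have h4 := min_le_right (R - ‖c i‖ - r) (L - 2 * r)
      refine ⟨?_, ?_⟩
      · rw [mem_ball_zero_iff]
        have := norm_sub_norm_le z (c i)
        rw [← dist_eq_norm] at this
        linarith
      · simp only [mem_iUnion, not_exists, Metric.mem_closedBall, not_le]
        intro j hj
        have hij : i ≠ j := fun h => hi (h ▸ hj)
        have := dist_triangle_left (c i) (c j) z
        rw [hc i j hij] at this
        linarith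
  simpa [threeDiskDomain] using key Finset.univ

theorem isThreeDiskDomain_threeDiskDomain {r₀ : ℝ} (h0 : 0 < r₀) (h1 : r₀ < 1) :
    IsThreeDiskDomain r₀ (triangleVertex (1 + 2 * r₀)) (Metric.ball 0 10)
      (threeDiskDomain (triangleVertex (1 + 2 * r₀)) r₀ 10) := by
  have hd := dist_triangleVertex (L := 1 + 2 * r₀) (by linarith)
  have hR : ∀ i, ‖triangleVertex (1 + 2 * r₀) i‖ + r₀ < 9 := fun i => by
    linarith [norm_triangleVertex_le (L := 1 + 2 * r₀) (by linarith) i]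
  have hR' : ∀ i, ‖triangleVertex (1 + 2 * r₀) i‖ + r₀ < 10 := fun i => by linarith [hR i]
  refine ⟨hd, Metric.isOpen_ball, ?_, ?_, ?_, rfl, isOpen_threeDiskDomain,
    Metric.isBounded_ball.subset sdiff_subset,
    ⟨?_, isPreconnected_threeDiskDomain hd h0.le (by linarith) hR'⟩,
    hasSmoothBoundary_threeDiskDomain hd h0 (by linarith) (by norm_num) hR'⟩
  · exact (convex_ball _ _).isConnected ⟨0, by simp⟩
  · rw [frontier_ball _ (by norm_num)]
    exact isConnected_sphere one_lt_rank_plane _ (by norm_num)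
  · refine convexHull_min (iUnion_subset fun i z hz => ?_) (convex_ball _ _)
    rw [Metric.mem_closedBall, dist_eq_norm] at hz
    rw [mem_ball_zero_iff]
    have := norm_sub_norm_le z (triangleVertex (1 + 2 * r₀) i)
    linarith [hR' i]
  · have hn : ‖(EuclideanSpace.single 0 9 : Plane)‖ = 9 := by simp
    refine ⟨EuclideanSpace.single 0 9, mem_threeDiskDomain.2 ⟨by rw [hn]; norm_num, fun i => ?_⟩⟩
    have := norm_sub_norm_le (EuclideanSpace.single 0 9 : Plane) (triangleVertex (1 + 2 * r₀) i)
    rw [dist_eq_norm]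
    linarith [hR i]

end Domain


/-! ### Polygonal lines traveled at unit speed. -/

section Times

variable {τ : ℤ → ℝ}

/-- Gaps of at least one make the times unbounded in both directions, so the trajectory is defined
for all times and bounces do not accumulate. -/
theorem exists_mem_Ico_of_add_one_le (hτ : ∀ m, τ m + 1 ≤ τ (m + 1)) (t : ℝ) :
    ∃ m, t ∈ Ico (τ m) (τ (m + 1)) := by
  have hmono : StrictMono τ := strictMono_int_of_lt_succ fun m => by linarith [hτ m]
  have h1 : ∀ n : ℕ, τ 0 + n ≤ τ n := by
    intro n
    induction n with
    | zero => simp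
    | succ n ih =>
      have := hτ n
      push_cast
      linarith
  have h2 : ∀ n : ℕ, τ (-n) + n ≤ τ 0 := by
    intro n
    induction n with
    | zero => simp
    | succ n ih =>
      have := hτ (-((n + 1 : ℕ) : ℤ))
      rw [show -((n + 1 : ℕ) : ℤ) + 1 = -(n : ℤ) by push_cast; ring] at this
      push_cast at this ⊢
      linarith
  obtain ⟨n, hn⟩ := exists_nat_gt (t - τ 0)
  obtain ⟨k, hk⟩ := exists_nat_gt (τ 0 - t)
  obtain ⟨m, hm, hmax⟩ := Int.exists_greatest_of_bdd (P := fun m => τ m ≤ t)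
    ⟨n, fun z hz => by
      by_contra! hlt
      have := hmono hlt
      linarith [h1 n]⟩ ⟨-k, by linarith [h2 k]⟩
  refine ⟨m, hm, ?_⟩
  by_contra! h
  have := hmax (m + 1) h
  omega

theorem notMem_range_of_mem_Ioo (hτ : StrictMono τ) {m : ℤ} {t : ℝ}
    (ht : t ∈ Ioo (τ m) (τ (m + 1))) : t ∉ range τ := by
  rintro ⟨k, rfl⟩
  have h1 := hτ.lt_iff_lt.1 ht.1
  have h2 := hτ.lt_iff_lt.1 ht.2
  omega

end Times

section Polyline

variable {E : Type*} [NormedAddCommGroup E] [NormedSpace ℝ E]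

/-- The unit vector in the direction of the `m`-th side of a polygonal line. -/
def sideDirection (P : ℤ → E) (m : ℤ) : E := ‖P (m + 1) - P m‖⁻¹ • (P (m + 1) - P m)

/-- `(y, w)` runs through the polygonal line with vertices `P m` at unit speed, reaching `P m` at
the time `τ m`. -/
structure IsUnitSpeedPolyline (P : ℤ → E) (τ : ℤ → ℝ) (y w : ℝ → E) : Prop where
  one_le_norm : ∀ m, 1 ≤ ‖P (m + 1) - P m‖
  time_succ : ∀ m, τ (m + 1) = τ m + ‖P (m + 1) - P m‖
  position : ∀ m, ∀ t ∈ Ico (τ m) (τ (m + 1)), y t = P m + (t - τ m) • sideDirection P m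
  velocity : ∀ m, ∀ t ∈ Ico (τ m) (τ (m + 1)), w t = sideDirection P m

theorem exists_isUnitSpeedPolyline {P : ℤ → E} {τ : ℤ → ℝ}
    (h1 : ∀ m, 1 ≤ ‖P (m + 1) - P m‖) (h2 : ∀ m, τ (m + 1) = τ m + ‖P (m + 1) - P m‖) :
    ∃ y w, IsUnitSpeedPolyline P τ y w := by
  have hstep : ∀ m, τ m + 1 ≤ τ (m + 1) := fun m => by linarith [h1 m, h2 m]
  have hmono : StrictMono τ := strictMono_int_of_lt_succ fun m => by linarith [hstep m]
  choose idx hidx using exists_mem_Ico_of_add_one_le hstep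
  have huniq : ∀ m, ∀ t ∈ Ico (τ m) (τ (m + 1)), idx t = m := by
    intro m t ht
    have a := hmono.lt_iff_lt.1 ((hidx t).1.trans_lt ht.2)
    have b := hmono.lt_iff_lt.1 (ht.1.trans_lt (hidx t).2)
    omega
  refine ⟨fun t => P (idx t) + (t - τ (idx t)) • sideDirection P (idx t),
    fun t => sideDirection P (idx t), h1, h2, fun m t ht => ?_, fun m t ht => ?_⟩
  · simp only [huniq m t ht]
  · simp only [huniq m t ht]

namespace IsUnitSpeedPolyline

variable {P : ℤ → E} {τ : ℤ → ℝ} {y w : ℝ → E} (h : IsUnitSpeedPolyline P τ y w)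

include h

theorem add_one_le (m : ℤ) : τ m + 1 ≤ τ (m + 1) := by
  linarith [h.one_le_norm m, h.time_succ m]

theorem strictMono : StrictMono τ :=
  strictMono_int_of_lt_succ fun m => by linarith [h.add_one_le m]

theorem norm_smul_sideDirection (m : ℤ) :
    ‖P (m + 1) - P m‖ • sideDirection P m = P (m + 1) - P m := by
  have := h.one_le_norm m
  rw [sideDirection, smul_smul, mul_inv_cancel₀ (by linarith), one_smul]

theorem norm_sideDirection (m : ℤ) : ‖sideDirection P m‖ = 1 := by
  have := h.one_le_norm m
  rw [sideDirection, norm_smul, norm_inv, norm_norm, inv_mul_cancel₀ (by linarith)]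

theorem position_vertex (m : ℤ) : y (τ m) = P m := by
  rw [h.position m _ ⟨le_rfl, by linarith [h.add_one_le m]⟩, sub_self, zero_smul, add_zero]

theorem position_Icc {m : ℤ} {t : ℝ} (ht : t ∈ Icc (τ m) (τ (m + 1))) :
    y t = P m + (t - τ m) • sideDirection P m := by
  rcases ht.2.lt_or_eq with h1 | rfl
  · exact h.position m t ⟨ht.1, h1⟩
  · rw [h.position_vertex, h.time_succ, add_sub_cancel_left, h.norm_smul_sideDirection]
    abel

theorem position_Icc' {m : ℤ} {t : ℝ} (ht : t ∈ Icc (τ m) (τ (m + 1))) :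
    y t = P (m + 1) - (τ (m + 1) - t) • sideDirection P m := by
  rw [h.position_Icc ht, show τ (m + 1) - t = ‖P (m + 1) - P m‖ - (t - τ m) by
    rw [h.time_succ]; ring, sub_smul ‖P (m + 1) - P m‖, h.norm_smul_sideDirection]
  abel

theorem mem_segment {m : ℤ} {t : ℝ} (ht : t ∈ Icc (τ m) (τ (m + 1))) :
    y t ∈ segment ℝ (P m) (P (m + 1)) := by
  have h1 := h.one_le_norm m
  have h2 := h.time_succ m
  have hpos : 0 < ‖P (m + 1) - P m‖ := by linarith
  rw [segment_eq_image']
  refine ⟨(t - τ m) / ‖P (m + 1) - P m‖, ⟨div_nonneg (by linarith [ht.1]) hpos.le, ?_⟩, ?_⟩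
  · rw [div_le_one hpos]
    linarith [ht.2]
  · rw [h.position_Icc ht, sideDirection, smul_smul, div_eq_mul_inv]

theorem continuous : Continuous y := by
  have hIcc : ∀ m, ContinuousOn y (Icc (τ m) (τ (m + 1))) := by
    intro m
    have : ContinuousOn (fun t => P m + (t - τ m) • sideDirection P m)
        (Icc (τ m) (τ (m + 1))) := by fun_prop
    exact this.congr fun t ht => h.position_Icc ht
  rw [continuous_iff_continuousAt]
  intro t
  obtain ⟨m, hm⟩ := exists_mem_Ico_of_add_one_le h.add_one_le t
  have hprev : τ (m - 1) < τ m := h.strictMono (by omega)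
  have h1 := hIcc (m - 1)
  rw [sub_add_cancel] at h1
  have h2 : ContinuousOn y (Icc (τ (m - 1)) (τ m) ∪ Icc (τ m) (τ (m + 1))) :=
    h1.union_of_isClosed (hIcc m) isClosed_Icc isClosed_Icc
  rw [Icc_union_Icc_eq_Icc hprev.le (by linarith [h.add_one_le m])] at h2
  exact h2.continuousAt (Icc_mem_nhds (by linarith [hm.1]) hm.2)

theorem exists_mem_Ioo {t : ℝ} (ht : t ∉ range τ) : ∃ m, t ∈ Ioo (τ m) (τ (m + 1)) := by
  obtain ⟨m, hm⟩ := exists_mem_Ico_of_add_one_le h.add_one_le t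
  exact ⟨m, lt_of_le_of_ne hm.1 fun e => ht ⟨m, e⟩, hm.2⟩

theorem norm_velocity {t : ℝ} (ht : t ∉ range τ) : ‖w t‖ = 1 := by
  obtain ⟨m, hm⟩ := h.exists_mem_Ioo ht
  rw [h.velocity m t (Ioo_subset_Ico_self hm), h.norm_sideDirection]

theorem hasDerivAt {t : ℝ} (ht : t ∉ range τ) : HasDerivAt y (w t) t := by
  obtain ⟨m, hm⟩ := h.exists_mem_Ioo ht
  rw [h.velocity m t (Ioo_subset_Ico_self hm)]
  have h1 : HasDerivAt (fun t => P m + (t - τ m) • sideDirection P m) (sideDirection P m) t := by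
    simpa using (((hasDerivAt_id t).sub_const (τ m)).smul_const (sideDirection P m)).const_add (P m)
  refine h1.congr_of_eventuallyEq ?_
  filter_upwards [Ioo_mem_nhds hm.1 hm.2] with s hs
  exact h.position m s (Ioo_subset_Ico_self hs)

theorem hasDerivAt_velocity {t : ℝ} (ht : t ∉ range τ) : HasDerivAt w 0 t := by
  obtain ⟨m, hm⟩ := h.exists_mem_Ioo ht
  refine (hasDerivAt_const t (sideDirection P m)).congr_of_eventuallyEq ?_
  filter_upwards [Ioo_mem_nhds hm.1 hm.2] with s hs
  exact h.velocity m s (Ioo_subset_Ico_self hs)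

theorem tendsto_velocity_right (m : ℤ) :
    Tendsto w (𝓝[>] (τ m)) (𝓝 (sideDirection P m)) := by
  refine tendsto_const_nhds.congr' ?_
  filter_upwards [Ioo_mem_nhdsGT (h.strictMono (lt_add_one m))] with s hs
  exact (h.velocity m s (Ioo_subset_Ico_self hs)).symm

theorem tendsto_velocity_left (m : ℤ) :
    Tendsto w (𝓝[<] (τ (m + 1))) (𝓝 (sideDirection P m)) := by
  refine tendsto_const_nhds.congr' ?_
  filter_upwards [Ioo_mem_nhdsLT (h.strictMono (lt_add_one m))] with s hs
  exact (h.velocity m s (Ioo_subset_Ico_self hs)).symm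

end IsUnitSpeedPolyline

end Polyline

/-! ### Minimal chains are billiard trajectories. -/

/-- A bi-infinite polygonal line with vertices on the disks around the points `c (I m)`, each vertex
of which minimizes the sum of the distances to its neighbors. -/
structure IsMinimalChain (c : Fin 3 → Plane) (r : ℝ) (I : ℤ → Fin 3) (P : ℤ → Plane) : Prop where
  ne_succ : ∀ m, I m ≠ I (m + 1)
  mem_closedBall : ∀ m, P m ∈ Metric.closedBall (c (I m)) r
  minimal : ∀ m, ∀ z ∈ Metric.closedBall (c (I (m + 1))) r,
    dist (P m) (P (m + 1)) + dist (P (m + 1)) (P (m + 1 + 1)) ≤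
      dist (P m) z + dist z (P (m + 1 + 1))

namespace IsMinimalChain

variable {c : Fin 3 → Plane} {r R L : ℝ} {I : ℤ → Fin 3} {P : ℤ → Plane} {τ : ℤ → ℝ}
  {y w : ℝ → Plane}

theorem one_le_norm (hP : IsMinimalChain c r I P)
    (hc : ∀ i j, i ≠ j → dist (c i) (c j) = 1 + 2 * r) (m : ℤ) : 1 ≤ ‖P (m + 1) - P m‖ := by
  have h1 := hP.mem_closedBall m
  have h2 := hP.mem_closedBall (m + 1)
  rw [Metric.mem_closedBall] at h1 h2
  have h3 := dist_triangle4 (c (I m)) (P m) (P (m + 1)) (c (I (m + 1)))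
  rw [hc _ _ (hP.ne_succ m), dist_comm (c (I m))] at h3
  rw [← dist_eq_norm, dist_comm]
  linarith

/-- The absence of eclipses supplies the nondegeneracy needed in Fermat's principle: a vertex never
lies between its neighbors. -/
theorem reflection (hP : IsMinimalChain c r I P) (hr : 0 < r) (hr' : r < 1 / 4)
    (hc : ∀ i j, i ≠ j → dist (c i) (c j) = 1 + 2 * r) (m : ℤ) :
    ‖P (m + 1) - c (I (m + 1))‖ = r ∧
      ⟪P (m + 1) - c (I (m + 1)), sideDirection P m⟫ < 0 ∧
      0 < ⟪P (m + 1) - c (I (m + 1)), sideDirection P (m + 1)⟫ ∧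
      sideDirection P (m + 1) = sideDirection P m -
        (2 * ⟪‖P (m + 1) - c (I (m + 1))‖⁻¹ • (P (m + 1) - c (I (m + 1))), sideDirection P m⟫) •
          (‖P (m + 1) - c (I (m + 1))‖⁻¹ • (P (m + 1) - c (I (m + 1)))) := by
  have hne : ∀ k, P k ≠ P (k + 1) := fun k e => by
    have := hP.one_le_norm hc k
    rw [e, sub_self, norm_zero] at this
    linarith
  refine reflection_of_isMinOn hr (hP.mem_closedBall _) (hne m) (hne (m + 1)).symm ?_
    (hP.minimal m)
  intro hseg
  exact notMem_closedBall_of_mem_segment hc hr.le (by linarith) (hP.ne_succ m)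
    (hP.ne_succ (m + 1)).symm (hP.mem_closedBall _) (hP.mem_closedBall _) hseg
    (hP.mem_closedBall _)

theorem norm_sub_eq (hP : IsMinimalChain c r I P) (hr : 0 < r) (hr' : r < 1 / 4)
    (hc : ∀ i j, i ≠ j → dist (c i) (c j) = 1 + 2 * r) (m : ℤ) : ‖P m - c (I m)‖ = r := by
  have := (hP.reflection hr hr' hc (m - 1)).1
  rwa [sub_add_cancel] at this

theorem norm_lt_of_mem_segment (hP : IsMinimalChain c r I P) (hR : ∀ i, ‖c i‖ + r < R) {m : ℤ}
    {z : Plane} (hz : z ∈ segment ℝ (P m) (P (m + 1))) : ‖z‖ < R := by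
  have h : ∀ m, P m ∈ Metric.ball (0 : Plane) R := fun m => by
    have h1 := hP.mem_closedBall m
    have h2 := norm_sub_norm_le (P m) (c (I m))
    rw [Metric.mem_closedBall, dist_eq_norm] at h1
    rw [mem_ball_zero_iff]
    linarith [hR (I m)]
  exact mem_ball_zero_iff.1 ((convex_ball (0 : Plane) R).segment_subset (h m) (h (m + 1)) hz)

/-- Between two consecutive vertices the trajectory runs inside the domain. -/
theorem mem_threeDiskDomain (hP : IsMinimalChain c r I P) (h : IsUnitSpeedPolyline P τ y w)
    (hr : 0 < r) (hr' : r < 1 / 4) (hc : ∀ i j, i ≠ j → dist (c i) (c j) = 1 + 2 * r)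
    (hR : ∀ i, ‖c i‖ + r < R) {m : ℤ} {t : ℝ} (ht : t ∈ Ioo (τ m) (τ (m + 1))) :
    y t ∈ threeDiskDomain c r R := by
  have hseg := h.mem_segment (Ioo_subset_Icc_self ht)
  rw [_root_.mem_threeDiskDomain]
  refine ⟨hP.norm_lt_of_mem_segment hR hseg, fun k => ?_⟩
  -- A ray that starts on the circle into the outer half-plane never comes back to the disk. This
  -- treats the disk of departure and, with time reversed, the disk of arrival.
  have key : ∀ (a d : Plane) (s : ℝ), ‖a‖ = r → 0 < s → 0 < ⟪a, d⟫ → r < ‖a + s • d‖ := by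
    intro a d s ha hs had
    have h1 := norm_add_sq_real a (s • d)
    rw [real_inner_smul_right, ha] at h1
    have h2 := mul_pos hs had
    refine lt_of_pow_lt_pow_left₀ 2 (norm_nonneg _) ?_
    nlinarith [sq_nonneg ‖s • d‖]
  by_cases hk1 : I m = k
  · have h1 := (hP.reflection hr hr' hc (m - 1)).2.2.1
    rw [sub_add_cancel] at h1
    have := key _ _ (t - τ m) (hP.norm_sub_eq hr hr' hc m) (by linarith [ht.1]) h1
    rw [h.position_Icc (Ioo_subset_Icc_self ht), ← hk1, dist_eq_norm, add_sub_right_comm]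
    exact this
  by_cases hk2 : I (m + 1) = k
  · have h1 := (hP.reflection hr hr' hc m).2.1
    have := key _ (-sideDirection P m) (τ (m + 1) - t) (hP.norm_sub_eq hr hr' hc (m + 1))
      (by linarith [ht.2]) (by rw [inner_neg_right]; linarith)
    rw [h.position_Icc' (Ioo_subset_Icc_self ht), ← hk2, dist_eq_norm, sub_right_comm]
    rwa [smul_neg, ← sub_eq_add_neg] at this
  · have := notMem_closedBall_of_mem_segment hc hr.le (by linarith) hk1 hk2 (hP.mem_closedBall m)
      (hP.mem_closedBall (m + 1)) hseg
    rwa [Metric.mem_closedBall, not_le] at this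

/-- The boundary is met only at the vertices, and transversally there, so the condition at
tangential points is vacuous. -/
theorem isGeneralizedBicharacteristic (hP : IsMinimalChain c r I P)
    (h : IsUnitSpeedPolyline P τ y w) (hr : 0 < r) (hr' : r < 1 / 4)
    (hc : ∀ i j, i ≠ j → dist (c i) (c j) = 1 + 2 * r) (hR : ∀ i, ‖c i‖ + r < R) :
    IsGeneralizedBicharacteristic (threeDiskDomain c r R) y w (range τ) := by
  have hin : ∀ t, t ∉ range τ → y t ∈ threeDiskDomain c r R := fun t ht => by
    obtain ⟨m, hm⟩ := h.exists_mem_Ioo ht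
    exact hP.mem_threeDiskDomain h hr hr' hc hR hm
  have hev : ∀ m, ∀ᶠ s in 𝓝[≠] (τ (m + 1)), s ∉ range τ ∧ y s ∈ threeDiskDomain c r R := by
    intro m
    have h1 : Ioo (τ m) (τ (m + 1 + 1)) ∈ 𝓝 (τ (m + 1)) :=
      Ioo_mem_nhds (h.strictMono (lt_add_one m)) (h.strictMono (lt_add_one (m + 1)))
    filter_upwards [nhdsWithin_le_nhds h1, self_mem_nhdsWithin] with s hs hne
    have hs' : s ∉ range τ := by
      rcases lt_or_gt_of_ne (show s ≠ τ (m + 1) from hne) with h' | h'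
      · exact notMem_range_of_mem_Ioo h.strictMono ⟨hs.1, h'⟩
      · exact notMem_range_of_mem_Ioo h.strictMono ⟨h', hs.2⟩
    exact ⟨hs', hin s hs'⟩
  have hcl : ∀ t, y t ∈ closure (threeDiskDomain c r R) := by
    intro t
    by_cases ht : t ∈ range τ
    · obtain ⟨m, rfl⟩ := ht
      have := hev (m - 1)
      rw [sub_add_cancel] at this
      exact mem_closure_of_tendsto (h.continuous.continuousAt.mono_left nhdsWithin_le_nhds)
        (this.mono fun s hs => hs.2)
    · exact subset_closure (hin t ht)
  refine ⟨h.continuous, hcl, fun t ht => h.norm_velocity ht,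
    fun t ht => (h.hasDerivAt ht).hasDerivWithinAt,
    fun t ht _ => (h.hasDerivAt_velocity ht).hasDerivWithinAt, fun t ht hfr => ?_, ?_⟩
  · rw [isOpen_threeDiskDomain.frontier_eq] at hfr
    exact absurd (hin t ht) hfr.2
  · rintro _ ⟨m, rfl⟩
    obtain ⟨m, rfl⟩ : ∃ k, m = k + 1 := ⟨m - 1, by ring⟩
    obtain ⟨h1, h2, -, h4⟩ := hP.reflection hr hr' hc m
    refine ⟨?_, hev m, fun q => ‖q - c (I (m + 1))‖ ^ 2 - r ^ 2, ?_, _, _, h.tendsto_velocity_left m, h.tendsto_velocity_right (m + 1), ?_,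
      ?_⟩
    · rw [isOpen_threeDiskDomain.frontier_eq]
      refine ⟨hcl _, fun hmem => ?_⟩
      have := (_root_.mem_threeDiskDomain.1 hmem).2 (I (m + 1))
      rw [h.position_vertex, dist_eq_norm, h1] at this
      exact lt_irrefl _ this
    · rw [h.position_vertex]
      exact isBoundaryDefining_disk hc hr (by linarith) hR h1
    · rw [h.position_vertex, innerNormal_disk hr h1, real_inner_smul_left, h1]
      exact mul_ne_zero (inv_ne_zero hr.ne') h2.ne
    · rw [h.position_vertex, innerNormal_disk hr h1]
      exact h4

end IsMinimalChain


/-! ### Bi-infinite sequences. -/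

theorem exists_int_primitive (d : ℤ → ℝ) :
    ∃ τ : ℤ → ℝ, τ 0 = 0 ∧ ∀ m, τ (m + 1) = τ m + d m := by
  let τ : ℤ → ℝ
    | Int.ofNat n => ∑ k ∈ Finset.range n, d k
    | Int.negSucc n => -∑ k ∈ Finset.range (n + 1), d (Int.negSucc k)
  refine ⟨τ, by change ∑ k ∈ Finset.range 0, d k = 0; simp, fun m => ?_⟩
  rcases m with n | n
  · exact Finset.sum_range_succ (fun k : ℕ => d k) n
  · rcases n with _ | n
    · change ∑ k ∈ Finset.range 0, d k = -∑ k ∈ Finset.range (0 + 1), d (Int.negSucc k) + _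
      simp
    · change -∑ k ∈ Finset.range (n + 1), d (Int.negSucc k) =
        -∑ k ∈ Finset.range (n + 1 + 1), d (Int.negSucc k) + _
      rw [Finset.sum_range_succ _ (n + 1)]
      ring

/-- The folding of the integers onto `{0, …, N}`. -/
theorem exists_folding {N : ℕ} (hN : 0 < N) :
    ∃ f : ℤ → ℕ, (∀ k : ℕ, k ≤ N → f k = k) ∧ ∀ m, f m ≤ N ∧
      ((f (m + 1) = f m + 1 ∧ f (m + 1 + 1) = f m + 1 + 1) ∨
        (f (m + 1) = f (m + 1 + 1) + 1 ∧ f m = f (m + 1 + 1) + 1 + 1) ∨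
        (f m = 1 ∧ f (m + 1) = 0 ∧ f (m + 1 + 1) = 1) ∨
        (f m + 1 = N ∧ f (m + 1) = N ∧ f (m + 1 + 1) + 1 = N)) := by
  have hsucc : ∀ m : ℤ, (m + 1) % (2 * N) = if m % (2 * N) + 1 = 2 * N then 0 else
      m % (2 * N) + 1 := by
    intro m
    have h1 := Int.emod_nonneg m (b := 2 * N) (by omega)
    have h2 := Int.emod_lt_of_pos m (b := 2 * N) (by omega)
    rw [← Int.emod_add_emod]
    split_ifs with h
    · rw [h, Int.emod_self]
    · exact Int.emod_eq_of_lt (by omega) (by omega)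
  -- The triangle wave of period `2 * N`. The four alternatives are the ascent, the descent and the
  -- turns at `0` and at `N`.
  refine ⟨fun m => (min (m % (2 * N)) (2 * N - m % (2 * N))).toNat, fun k hk => ?_, fun m => ?_⟩
  · simp only
    rw [Int.emod_eq_of_lt (by omega) (by omega)]
    omega
  · simp only
    rw [hsucc (m + 1), hsucc m]
    have h1 := Int.emod_nonneg m (b := 2 * N) (by omega)
    have h2 := Int.emod_lt_of_pos m (b := 2 * N) (by omega)
    generalize m % (2 * (N : ℤ)) = r at *
    refine ⟨by omega, ?_⟩
    split_ifs <;> omega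

/-! ### Value functions and shortest chains. -/

section ValueFunction

variable {E : Type*} [PseudoMetricSpace E]

/-- The least cost of reaching `z` from a point of `K`, where `V` is the cost on `K`. -/
def nextValue (K : Set E) (V : E → ℝ) (z : E) : ℝ := sInf ((fun q => V q + dist q z) '' K)

theorem exists_nextValue_eq {K : Set E} (hK : IsCompact K) (hne : K.Nonempty) {V : E → ℝ}
    (hV : LipschitzWith 1 V) (z : E) : ∃ q ∈ K, nextValue K V z = V q + dist q z := by
  have hcont : Continuous fun q => V q + dist q z :=
    hV.continuous.add (continuous_id.dist continuous_const)
  exact hK.exists_sInf_image_eq hne hcont.continuousOn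

theorem nextValue_le {K : Set E} (hK : IsCompact K) {V : E → ℝ}
    (hV : LipschitzWith 1 V) (z : E) {q : E} (hq : q ∈ K) :
    nextValue K V z ≤ V q + dist q z := by
  have hcont : Continuous fun q => V q + dist q z :=
    hV.continuous.add (continuous_id.dist continuous_const)
  exact csInf_le (hK.bddBelow_image hcont.continuousOn) (mem_image_of_mem _ hq)

/-- An infimum of 1-Lipschitz functions of `z`. This is what bounds the error in a bounce time by
the error in the bounce point. -/
theorem lipschitzWith_nextValue {K : Set E} (hK : IsCompact K) (hne : K.Nonempty) {V : E → ℝ}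
    (hV : LipschitzWith 1 V) : LipschitzWith 1 (nextValue K V) := by
  refine LipschitzWith.of_le_add fun z z' => ?_
  obtain ⟨q, hq, he⟩ := exists_nextValue_eq hK hne hV z'
  have h1 := nextValue_le hK hV z hq
  have h2 := dist_triangle_right q z z'
  linarith

/-- `V n z` is the length of a shortest chain that visits `K 0, …, K (n - 1)` and ends at `z`. -/
structure IsChainValue (K : ℕ → Set E) (V : ℕ → E → ℝ) : Prop where
  zero : ∀ z, V 0 z = 0
  lipschitz : ∀ n, LipschitzWith 1 (V n)
  exists_eq : ∀ n z, ∃ q ∈ K n, V (n + 1) z = V n q + dist q z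
  le : ∀ n z, ∀ q ∈ K n, V (n + 1) z ≤ V n q + dist q z

/-- Optimal predecessors are traced back from the end point `z`, which itself need not lie in `K N`.
-/
theorem IsChainValue.exists_chain {K : ℕ → Set E} {V : ℕ → E → ℝ} (h : IsChainValue K V) (N : ℕ)
    (z : E) : ∃ p : ℕ → E, p N = z ∧ ∀ k < N, p k ∈ K k ∧
      V (k + 1) (p (k + 1)) = V k (p k) + dist (p k) (p (k + 1)) := by
  induction N generalizing z with
  | zero => exact ⟨fun _ => z, rfl, fun k hk => absurd hk (Nat.not_lt_zero k)⟩
  | succ N ih =>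
    obtain ⟨q, hq, he⟩ := h.exists_eq N z
    obtain ⟨p, hp, hk⟩ := ih q
    refine ⟨fun k => if k ≤ N then p k else z, by simp, fun k hkN => ?_⟩
    rcases (Nat.lt_succ_iff.1 hkN).lt_or_eq with hlt | rfl
    · simpa [hlt.le, Nat.succ_le_of_lt hlt] using hk k hlt
    · simpa [hp, hq] using he

/-- Bellman's principle: moving one vertex to `z` while keeping its predecessor gives a competitor
for `V (k + 1) z`, so optimality of the value yields local minimality. -/
theorem dist_le_of_value_eq {K : ℕ → Set E} {V : ℕ → E → ℝ} (h : IsChainValue K V) {N : ℕ}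
    {p : ℕ → E} (hp : ∀ k < N, p k ∈ K k ∧
      V (k + 1) (p (k + 1)) = V k (p k) + dist (p k) (p (k + 1))) {k : ℕ} (hk : k < N) {z b : E}
    (hz : V (k + 1) (p (k + 1)) + dist (p (k + 1)) b ≤ V (k + 1) z + dist z b) :
    dist (p k) (p (k + 1)) + dist (p (k + 1)) b ≤ dist (p k) z + dist z b := by
  linarith [h.le k z (p k) (hp k hk).1, (hp k hk).2]

end ValueFunction

/-- Both end points are free in their disks: the first because `V 0 = 0`, the last because it
minimizes `V N`. Each is therefore nearest to its only neighbor, and the chain can be run back and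
forth through the folding without losing minimality at the turns. -/
theorem exists_isMinimalChain {c : Fin 3 → Plane} {r : ℝ} (hr : 0 ≤ r) {I : ℕ → Fin 3}
    {V : ℕ → Plane → ℝ}
    (hV : IsChainValue (fun n => Metric.closedBall (c (I n)) r) V) (hI : ∀ n, I (n + 1) ≠ I n)
    {N : ℕ} (hN : 0 < N) :
    ∃ (J : ℤ → Fin 3) (P : ℤ → Plane), IsMinimalChain c r J P ∧
      (∀ k : ℕ, k ≤ N → J k = I k) ∧ ∀ k : ℕ, k < N →
        V (k + 1) (P (k + 1 : ℕ)) = V k (P k) + dist (P k) (P (k + 1 : ℕ)) := by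
  obtain ⟨z, hz, hzmin⟩ := (isCompact_closedBall (c (I N)) r).exists_isMinOn
    ⟨_, Metric.mem_closedBall_self hr⟩ (hV.lipschitz N).continuous.continuousOn
  obtain ⟨p, hpN, hp⟩ := hV.exists_chain N z
  obtain ⟨f, hf, hfold⟩ := exists_folding hN
  have hmem : ∀ k ≤ N, p k ∈ Metric.closedBall (c (I k)) r := by
    intro k hk
    rcases hk.lt_or_eq with h | rfl
    · exact (hp k h).1
    · rwa [hpN]
  have hmid : ∀ k, k + 1 < N → ∀ q ∈ Metric.closedBall (c (I (k + 1))) r,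
      dist (p k) (p (k + 1)) + dist (p (k + 1)) (p (k + 1 + 1)) ≤
        dist (p k) q + dist q (p (k + 1 + 1)) := by
    intro k hk q hq
    refine dist_le_of_value_eq hV hp (by omega) ?_
    linarith [hV.le (k + 1) (p (k + 1 + 1)) q hq, (hp (k + 1) hk).2]
  have hlast : ∀ k, k + 1 = N → ∀ q ∈ Metric.closedBall (c (I (k + 1))) r,
      dist (p k) (p (k + 1)) ≤ dist (p k) q := by
    rintro k rfl q hq
    have h1 : V (k + 1) z ≤ V (k + 1) q := hzmin hq
    rw [← hpN] at h1
    linarith [hV.le k q (p k) (hp k (by omega)).1, (hp k (by omega)).2]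
  have hfirst : ∀ q ∈ Metric.closedBall (c (I 0)) r, dist (p 0) (p 1) ≤ dist q (p 1) := by
    intro q hq
    have h1 := hV.le 0 (p 1) q hq
    have h2 := (hp 0 hN).2
    rw [hV.zero] at h1 h2
    linarith
  refine ⟨fun m => I (f m), fun m => p (f m), ⟨fun m => ?_, fun m => hmem _ (hfold m).1,
    fun m q hq => ?_⟩, fun k hk => by simp only [hf k hk], fun k hk => ?_⟩
  · rcases (hfold m).2 with ⟨h, -⟩ | ⟨h, h'⟩ | ⟨h, h', -⟩ | ⟨h, h', -⟩
    · rw [h]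
      exact (hI _).symm
    · rw [h', h]
      exact hI _
    · rw [h, h']
      exact hI 0
    · rw [h', ← h]
      exact (hI _).symm
  · have hle := (hfold (m + 1 + 1)).1
    rcases (hfold m).2 with ⟨h, h'⟩ | ⟨h, h'⟩ | ⟨h, h', h''⟩ | ⟨h, h', h''⟩
    · simp only [h, h'] at hq hle ⊢
      exact hmid _ hle q hq
    · have hle' := (hfold m).1
      simp only [h, h'] at hq hle' ⊢
      have := hmid _ hle' q hq
      generalize f (m + 1 + 1) = k at *
      linarith [dist_comm (p k) (p (k + 1)), dist_comm (p (k + 1)) (p (k + 1 + 1)),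
        dist_comm (p k) q, dist_comm q (p (k + 1 + 1))]
    · simp only [h, h', h''] at hq ⊢
      have := hfirst q hq
      rw [dist_comm (p 1) (p 0), dist_comm (p 1) q]
      linarith
    · have e : f (m + 1 + 1) = f m := by omega
      rw [h', ← h] at hq
      simp only [e, h', ← h]
      have := hlast _ h q hq
      rw [dist_comm _ (p (f m)), dist_comm q]
      linarith
  · simp only [hf k hk.le, hf (k + 1) hk]
    exact (hp k hk).2

/-! ### Evading the slow ball. -/

/-- Against a slow path `ξ` there is an itinerary such that, at the approximate time at which a
shortest chain reaches the `n`-th disk, the path is away from the next side. -/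
theorem exists_evading_itinerary {c : Fin 3 → Plane} {r v : ℝ} (hr : 0 < r) (hr' : r < 1 / 400)
    (hv' : v ≤ 1 / 400) (hc : ∀ i j, i ≠ j → dist (c i) (c j) = 1 + 2 * r)
    {ξ : ℝ → Plane} (hξ : ∀ s t, dist (ξ s) (ξ t) ≤ v * |s - t|) :
    ∃ (I : ℕ → Fin 3) (V : ℕ → Plane → ℝ),
      IsChainValue (fun n => Metric.closedBall (c (I n)) r) V ∧ (∀ n, I (n + 1) ≠ I n) ∧
      ∀ n, 1 + 2 * r + 1 / 40 ≤ dist (ξ (V n (c (I n)))) (c (I n)) +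
        dist (ξ (V n (c (I n)))) (c (I (n + 1))) := by
  -- For `x` near `c i` the choice is a dummy; the invariant `hfar` shows that this case never
  -- occurs.
  have hnext : ∀ (i : Fin 3) (x : Plane), ∃ j, 1 / 4 ≤ dist x (c i) →
      j ≠ i ∧ 1 + 2 * r + 1 / 40 ≤ dist x (c i) + dist x (c j) ∧ 3 / 10 ≤ dist x (c j) := by
    intro i x
    by_cases hx : 1 / 4 ≤ dist x (c i)
    · obtain ⟨j, hj⟩ := exists_side_far hc (by linarith) hx
      exact ⟨j, fun _ => hj⟩
    · exact ⟨i, fun h => absurd h hx⟩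
  choose nxt hnxt using hnext
  obtain ⟨i₀, hi₀⟩ := exists_vertex_far hc (by linarith) (ξ 0)
  -- The state is the current value function and the current disk. The next disk is chosen from the
  -- predicted time `V n (c (I n))`, which involves past choices only.
  let S : ℕ → (Plane → ℝ) × Fin 3 := fun n => Nat.rec ((fun _ => 0), i₀)
    (fun _ s => (nextValue (Metric.closedBall (c s.2) r) s.1, nxt s.2 (ξ (s.1 (c s.2))))) n
  have hK : ∀ i, IsCompact (Metric.closedBall (c i) r) := fun i => isCompact_closedBall _ _
  have hne : ∀ i, (Metric.closedBall (c i) r).Nonempty :=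
    fun i => ⟨_, Metric.mem_closedBall_self hr.le⟩
  have hlip : ∀ n, LipschitzWith 1 (S n).1 := by
    intro n
    induction n with
    | zero => exact LipschitzWith.const' 0
    | succ n ih => exact lipschitzWith_nextValue (hK _) (hne _) ih
  have hV : IsChainValue (fun n => Metric.closedBall (c (S n).2) r) (fun n => (S n).1) :=
    ⟨fun _ => rfl, hlip, fun n z => exists_nextValue_eq (hK _) (hne _) (hlip n) z,
      fun n z q hq => nextValue_le (hK _) (hlip n) z hq⟩
  -- Consecutive predicted times differ by at most 2, so the distance `3 / 10` to the chosen vertex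
  -- drops by at most `2 / 400` and stays above `1 / 4`.
  have hfar : ∀ n, 1 / 4 ≤ dist (ξ ((S n).1 (c (S n).2))) (c (S n).2) := by
    intro n
    induction n with
    | zero => exact hi₀
    | succ n ih =>
      obtain ⟨h1, -, h3⟩ := hnxt _ _ ih
      change (S (n + 1)).2 ≠ _ at h1
      change _ ≤ dist _ (c (S (n + 1)).2) at h3
      obtain ⟨q, hq, he⟩ := hV.exists_eq n (c (S (n + 1)).2)
      have h4 := (hlip n).dist_le_mul q (c (S n).2)
      rw [Metric.mem_closedBall] at hq
      have h5 := dist_triangle_left (c (S n).2) (c (S (n + 1)).2) q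
      have h5' := dist_triangle q (c (S n).2) (c (S (n + 1)).2)
      rw [hc _ _ h1.symm] at h5 h5'
      rw [Real.dist_eq, NNReal.coe_one, one_mul] at h4
      have h6 := abs_le.1 h4
      have h7 : |(S n).1 (c (S n).2) - (S (n + 1)).1 (c (S (n + 1)).2)| ≤ 2 := by
        rw [he, abs_le]
        constructor <;> linarith
      have h8 := hξ ((S n).1 (c (S n).2)) ((S (n + 1)).1 (c (S (n + 1)).2))
      have h9 := mul_le_mul hv' h7 (abs_nonneg _) (by norm_num)
      have h10 := dist_triangle (ξ ((S n).1 (c (S n).2)))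
        (ξ ((S (n + 1)).1 (c (S (n + 1)).2))) (c (S (n + 1)).2)
      linarith
  exact ⟨fun n => (S n).2, fun n => (S n).1, hV, fun n => (hnxt _ _ (hfar n)).1,
    fun n => (hnxt _ _ (hfar n)).2.1⟩

theorem exists_evading_geodesic {c : Fin 3 → Plane} {r R v ε : ℝ} (hr : 0 < r) (hr' : r < 1 / 400)
    (hv' : v ≤ 1 / 400) (hε : ε ≤ 1 / 400)
    (hc : ∀ i j, i ≠ j → dist (c i) (c j) = 1 + 2 * r) (hR : ∀ i, ‖c i‖ + r < R)
    {ξ : ℝ → Plane} (hξ : ∀ s t, dist (ξ s) (ξ t) ≤ v * |s - t|) (T : ℝ) :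
    ∃ y, IsGeneralizedGeodesic (threeDiskDomain c r R) y ∧ (∀ t, ‖y t‖ < R) ∧
      ∀ t ∈ Icc 0 T, ε ≤ dist (y t) (ξ t) := by
  obtain ⟨I, V, hV, hI, hgood⟩ := exists_evading_itinerary hr hr' hv' hc hξ
  -- Every leg has length at least 1, so `N` legs outlast `T`.
  obtain ⟨N, hN⟩ := exists_nat_gt (max T 0)
  have hN0 : 0 < N := by
    have := (le_max_right T 0).trans_lt hN
    exact_mod_cast this
  obtain ⟨J, P, hP, hJ, hval⟩ := exists_isMinimalChain hr.le hV hI hN0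
  obtain ⟨τ, hτ0, hτ⟩ := exists_int_primitive fun m => ‖P (m + 1) - P m‖
  obtain ⟨y, w, hy⟩ := exists_isUnitSpeedPolyline (hP.one_le_norm hc) hτ
  refine ⟨y, ⟨w, _, hP.isGeneralizedBicharacteristic hy hr (by linarith) hc hR⟩, fun t => ?_,
    fun t ht => ?_⟩
  · obtain ⟨m, hm⟩ := exists_mem_Ico_of_add_one_le hy.add_one_le t
    exact hP.norm_lt_of_mem_segment hR (hy.mem_segment (Ico_subset_Icc_self hm))
  -- Along the optimal chain the values telescope to the traveled length, so they are the true
  -- bounce times.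
  · have hτV : ∀ k : ℕ, k ≤ N → τ k = V k (P k) := by
      intro k
      induction k with
      | zero => intro _; rw [Nat.cast_zero, hτ0, hV.zero]
      | succ k ih =>
        intro hk
        rw [hval k hk, ← ih (by omega), Nat.cast_succ, hτ, dist_comm, dist_eq_norm]
    have hτge : ∀ k : ℕ, (k : ℝ) ≤ τ k := by
      intro k
      induction k with
      | zero => simp [hτ0]
      | succ k ih =>
        have := hy.add_one_le k
        push_cast
        linarith
    obtain ⟨m, hm⟩ := exists_mem_Ico_of_add_one_le hy.add_one_le t
    have hm0 : 0 < m + 1 := hy.strictMono.lt_iff_lt.1 (by rw [hτ0]; exact ht.1.trans_lt hm.2)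
    have hmN : m < N := hy.strictMono.lt_iff_lt.1
      (by linarith [hm.1, ht.2, le_max_left T 0, hτge N])
    lift m to ℕ using by omega
    have hmN' : m < N := by exact_mod_cast hmN
    have hseg := hy.mem_segment (Ico_subset_Icc_self hm)
    have b1 := hP.mem_closedBall m
    have b2 := hP.mem_closedBall (m + 1)
    have h1 := dist_add_dist_le_of_mem_segment b1 b2 hseg
    rw [hc _ _ (hP.ne_succ m)] at h1
    have hd := hτ m
    rw [← dist_eq_norm] at hd
    have h2 := dist_triangle4 (P (m + 1)) (c (J (m + 1))) (c (J m)) (P m)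
    rw [hc _ _ (hP.ne_succ m).symm] at h2
    rw [Metric.mem_closedBall] at b1 b2
    rw [dist_comm (c (J m))] at h2
    have h3 := (hV.lipschitz m).dist_le_mul (P m) (c (I m))
    rw [Real.dist_eq, NNReal.coe_one, one_mul, ← hτV m hmN'.le, ← hJ m hmN'.le] at h3
    have h4 := hgood m
    have e2 := hJ (m + 1) hmN'
    rw [Nat.cast_succ] at e2
    rw [← hJ m hmN'.le, ← e2] at h4
    set s := V m (c (J m))
    have h6 := abs_le.1 h3
    -- The predicted time `s` is within `r` of the true bounce time, and a leg lasts at most `1 + 4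
    -- * r`.
    have h7 : |s - t| ≤ 2 := by
      rw [abs_le]
      constructor <;> linarith [hm.1, hm.2]
    have h8 := hξ s t
    have h9 := mul_le_mul hv' h7 (abs_nonneg _) (by norm_num)
    -- The budget: the motion of `ξ` counts twice, at most `4 / 400`; the radius `ε` counts twice,
    -- at most `2 / 400`; the excess `4 * r` of the leg is below `4 / 400`. The total is less than
    -- `1 / 40`.
    by_contra! hlt
    have h10 := dist_triangle4 (ξ s) (ξ t) (y t) (c (J m))
    have h11 := dist_triangle4 (ξ s) (ξ t) (y t) (c (J (m + 1)))
    rw [dist_comm (ξ t)] at h10 h11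
    linarith

end

theorem theorem2 :
    ∃ r₁ : ℝ, 0 < r₁ ∧ ∀ r₀ : ℝ, 0 < r₀ → r₀ < r₁ →
      ∃ (c : Fin 3 → Plane) (U X : Set Plane), IsThreeDiskDomain r₀ c U X ∧
        ∃ ε₀ : ℝ, 0 < ε₀ ∧ ∃ v₀ : ℝ, 0 < v₀ ∧
          ∀ ε : ℝ, 0 < ε → ε ≤ ε₀ → ∀ v : ℝ, 0 < v → v ≤ v₀ →
            ∀ T : ℝ, 0 < T → ∀ x : ℝ → Plane, IsAdmissiblePath X T v x →
              ¬ SatisfiesTGCC X (movingBall X T ε x) T ∧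
              ∃ y : ℝ → Plane, IsGeneralizedGeodesic X y ∧ (∀ t, y t ∉ frontier U) ∧
                ∀ t ∈ Icc 0 T, y t ∉ Metric.ball (x t) ε := by
  refine ⟨1 / 400, by norm_num, fun r₀ h0 h1 => ⟨triangleVertex (1 + 2 * r₀), Metric.ball 0 10,
    threeDiskDomain (triangleVertex (1 + 2 * r₀)) r₀ 10,
    isThreeDiskDomain_threeDiskDomain h0 (by linarith), 1 / 400, by norm_num, 1 / 400, by norm_num,
    fun ε _ hε v hv0 hv T hT x hx => ?_⟩⟩
  have hR : ∀ i, ‖triangleVertex (1 + 2 * r₀) i‖ + r₀ < 10 := fun i => by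
    linarith [norm_triangleVertex_le (L := 1 + 2 * r₀) (by linarith) i]
  obtain ⟨y, hy, hyU, hyε⟩ := exists_evading_geodesic h0 h1 hv hε
    (dist_triangleVertex (by linarith)) hR (hx.dist_projIcc_le hT.le hv0.le) T
  have havoid : ∀ t ∈ Icc 0 T, y t ∉ Metric.ball (x t) ε := by
    intro t ht hmem
    have := hyε t ht
    rw [projIcc_of_mem hT.le ht] at this
    exact this.not_gt hmem
  refine ⟨fun hG => ?_, y, hy, fun t ht => ?_, havoid⟩
  · obtain ⟨t, ht, hQ⟩ := hG y hy
    exact havoid t (Ioo_subset_Icc_self ht) hQ.2.1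
  · rw [Metric.isOpen_ball.frontier_eq] at ht
    exact ht.2 (mem_ball_zero_iff.2 (hyU t))
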